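/- Let $\beta_n,\alpha_n^L,\alpha_n^R$ ($n\ge 0$) be complex polynomials of degree at most $1$, none identically zero, and let $A=(a_{i,j})_{i,j\ge 0}$, $B=(b_{i,j})_{i,j\ge 0}$ be the tridiagonal matrices with $$zb_{n,n}-a_{n,n}=\beta_n(z),\qquad zb_{n,n+1}-a_{n,n+1}=-\alpha_n^R(z),\qquad zb_{n+1,n}-a_{n+1,n}=-\alpha_n^L(z).$$ Assume that $A$ and $B$ have bounded entries, and regard them (via the usual matrix product) as bounded operators on $\ell^2=\ell^2_{[0:\infty)}$. Let $\rho(A,B)$ be the set of $z\in\mathbb C$ for which $zB-A$ has a bounded inverse on $\ell^2$, and let $m(z)=\langle (zB-A)^{-1}e_0,e_0\rangle$ for $z\in\rho(A,B)$, where $e_0=(1,0,0,\dots)^\top$. Let $p_n,q_n$ be the polynomials solving $$y_{n+1}=\beta_n(z)\,y_n-\alpha_{n-1}^L(z)\alpha_{n-1}^R(z)\,y_{n-1},\quad n\ge 0,\qquad \alpha_{-1}^L=\alpha_{-1}^R=1,$$ with $q_0=1,\ q_{-1}=0,\ p_0=0,\ p_{-1}=-1$, and put $m_{[0:n-1]}=p_n/q_n$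 for $n\ge0$. Theorem 3.5 (neighborhoods). For every $\xi\in\rho(A,B)$ there exist a closed neighborhood $V\subset\rho(A,B)$ of $\xi$ and numbers $\epsilon_n\in\{0,1\}$ ($n\ge 0$) such that $q_{n+\epsilon_n}$ has no zero in $V$ for any $n\ge0$, and $m_{[0:n-1+\epsilon_n]}$ converges to $m$ uniformly on $V$ as $n\to\infty$, at a geometric rate: there are constants $C>0$ and $\delta\in(0,1)$ with $$|m(z)-m_{[0:n-1+\epsilon_n]}(z)|\le C\,\delta^n\qquad\text{for all } n\ge 0 \text{ and all } z\in V.$$ -/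

import Mathlib

open Polynomial Topology Filter

noncomputable section

/-- The Hilbert space `ℓ²` of square summable complex sequences `(x₀, x₁, …)`. -/
abbrev Ell2 : Type := lp (fun _ : ℕ => ℂ) 2

/-- The first canonical vector `e₀ = (1, 0, 0, …)`. -/
def e0 : Ell2 := lp.single 2 (0 : ℕ) (1 : ℂ)

/-- An infinite matrix is tridiagonal. -/
def IsTridiagonal (M : Matrix ℕ ℕ ℂ) : Prop :=
  ∀ i j, i + 1 < j ∨ j + 1 < i → M i j = 0

/-- The entries of an infinite matrix are uniformly bounded. -/
def HasBoundedEntries (M : Matrix ℕ ℕ ℂ) : Prop :=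
  ∃ C : ℝ, ∀ i j, ‖M i j‖ ≤ C

theorem IsTridiagonal.tsum_eq {M : Matrix ℕ ℕ ℂ} (hM : IsTridiagonal M) (x : ℕ → ℂ) (i : ℕ) :
    ∑' j, M i j * x j = ∑ j ∈ Finset.Icc (i - 1) (i + 1), M i j * x j := by
  apply tsum_eq_sum
  intro j hj
  rw [Finset.mem_Icc] at hj
  rw [hM i j (by omega), zero_mul]

theorem IsTridiagonal.memℓp {M : Matrix ℕ ℕ ℂ} (hM : IsTridiagonal M)
    (hb : HasBoundedEntries M) (x : Ell2) :
    Memℓp (fun i => ∑' j, M i j * x j) 2 := by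
  obtain ⟨C, hC⟩ := hb
  have hx : Summable fun i => ‖x i‖ ^ (2 : ℝ) := by
    simpa using (lp.memℓp x).summable (by norm_num)
  have hx2 : Summable fun i => ‖x i‖ ^ 2 := by simpa using hx
  have hup : Summable fun i => ‖x (i + 1)‖ ^ 2 := (summable_nat_add_iff 1).2 hx2
  have hdn : Summable fun i => ‖x (i - 1)‖ ^ 2 := by
    rw [← summable_nat_add_iff 1]
    simpa using hx2
  apply memℓp_gen
  simp only [ENNReal.toReal_ofNat, Real.rpow_ofNat]
  refine Summable.of_nonneg_of_le (fun _ => by positivity) (fun i => ?_)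
    (((hdn.add hx2).add hup).mul_left (3 * C ^ 2))
  rw [hM.tsum_eq]
  have h1 : ‖∑ j ∈ Finset.Icc (i - 1) (i + 1), M i j * x j‖
      ≤ C * (‖x (i - 1)‖ + ‖x i‖ + ‖x (i + 1)‖) := by
    have hC0 : 0 ≤ C := (norm_nonneg _).trans (hC 0 0)
    refine (norm_sum_le _ _).trans ?_
    have h2 : ∀ j ∈ Finset.Icc (i - 1) (i + 1), ‖M i j * x j‖ ≤ C * ‖x j‖ := fun j _ => by
      rw [norm_mul]
      exact mul_le_mul_of_nonneg_right (hC i j) (norm_nonneg _)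
    refine (Finset.sum_le_sum h2).trans ?_
    rw [← Finset.mul_sum]
    refine mul_le_mul_of_nonneg_left ?_ hC0
    rcases i with _ | k
    · have : Finset.Icc (0 - 1) (0 + 1) = ({0, 1} : Finset ℕ) := by decide
      rw [this, Finset.sum_pair (by norm_num)]
      simp
    · have : Finset.Icc (k + 1 - 1) (k + 1 + 1) = ({k, k + 1, k + 2} : Finset ℕ) := by
        ext j
        simp only [Finset.mem_Icc, Finset.mem_insert, Finset.mem_singleton]
        omega
      rw [this, Finset.sum_insert (by simp), Finset.sum_pair (by simp)]
      simp [add_assoc]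
  calc ‖∑ j ∈ Finset.Icc (i - 1) (i + 1), M i j * x j‖ ^ 2
      ≤ (C * (‖x (i - 1)‖ + ‖x i‖ + ‖x (i + 1)‖)) ^ 2 := by gcongr
    _ = C ^ 2 * (‖x (i - 1)‖ + ‖x i‖ + ‖x (i + 1)‖) ^ 2 := by ring
    _ ≤ C ^ 2 * (3 * (‖x (i - 1)‖ ^ 2 + ‖x i‖ ^ 2 + ‖x (i + 1)‖ ^ 2)) := by
        gcongr
        nlinarith [sq_nonneg (‖x (i - 1)‖ - ‖x i‖), sq_nonneg (‖x i‖ - ‖x (i + 1)‖),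
          sq_nonneg (‖x (i - 1)‖ - ‖x (i + 1)‖)]
    _ = 3 * C ^ 2 * (‖x (i - 1)‖ ^ 2 + ‖x i‖ ^ 2 + ‖x (i + 1)‖ ^ 2) := by ring

/-- Usual matrix product `x ↦ M x`, as a linear map of `ℓ²`, for a tridiagonal matrix `M` with
bounded entries. -/
def matrixLinearMap (M : Matrix ℕ ℕ ℂ) (hM : IsTridiagonal M) (hb : HasBoundedEntries M) :
    Ell2 →ₗ[ℂ] Ell2 where
  toFun x := ⟨fun i => ∑' j, M i j * x j, hM.memℓp hb x⟩
  map_add' x y := by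
    ext i
    simp only [lp.coeFn_add, Pi.add_apply]
    rw [hM.tsum_eq, hM.tsum_eq, hM.tsum_eq, ← Finset.sum_add_distrib]
    exact Finset.sum_congr rfl fun j _ => by simp [mul_add]
  map_smul' c x := by
    ext i
    simp only [lp.coeFn_smul, Pi.smul_apply, RingHom.id_apply, smul_eq_mul]
    rw [hM.tsum_eq, hM.tsum_eq, Finset.mul_sum]
    exact Finset.sum_congr rfl fun j _ => by simp [mul_left_comm]

theorem continuous_coord (i : ℕ) : Continuous fun x : Ell2 => x i := by
  have h : LipschitzWith 1 fun x : Ell2 => x i := by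
    refine LipschitzWith.of_dist_le_mul fun x y => ?_
    rw [dist_eq_norm, dist_eq_norm, NNReal.coe_one, one_mul]
    exact lp.norm_apply_le_norm (by norm_num) (x - y) i
  exact h.continuous

/-- The bounded operator on `ℓ²` given by a tridiagonal matrix with bounded entries, acting by the
usual matrix product. -/
def matrixOperator (M : Matrix ℕ ℕ ℂ) (hM : IsTridiagonal M) (hb : HasBoundedEntries M) :
    Ell2 →L[ℂ] Ell2 :=
  ContinuousLinearMap.ofSeqClosedGraph (g := matrixLinearMap M hM hb) (by
    intro u x y hu hy
    ext i
    have h1 : Tendsto (fun n => ∑' j, M i j * u n j) atTop (𝓝 (y i)) :=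
      ((continuous_coord i).tendsto y).comp hy
    have h2 : Tendsto (fun n => ∑' j, M i j * u n j) atTop (𝓝 (∑' j, M i j * x j)) := by
      simp only [hM.tsum_eq]
      exact tendsto_finsetSum _ fun j _ =>
        (((continuous_coord j).tendsto x).comp hu).const_mul (M i j)
    exact tendsto_nhds_unique h1 h2)

theorem matrixOperator_apply (M : Matrix ℕ ℕ ℂ) (hM : IsTridiagonal M) (hb : HasBoundedEntries M)
    (x : Ell2) (i : ℕ) : matrixOperator M hM hb x i = ∑' j, M i j * x j := rfl

/-- Coefficients of a continued fraction
`1/β₀(z) - α₀ᴸ(z) α₀ᴿ(z)/β₁(z) - α₁ᴸ(z) α₁ᴿ(z)/β₂(z) - ⋯`: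
polynomials of degree at most `1`, none of them identically zero. -/
structure MPFraction where
  β : ℕ → ℂ[X]
  αL : ℕ → ℂ[X]
  αR : ℕ → ℂ[X]
  β_degree : ∀ n, (β n).natDegree ≤ 1
  αL_degree : ∀ n, (αL n).natDegree ≤ 1
  αR_degree : ∀ n, (αR n).natDegree ≤ 1
  β_ne_zero : ∀ n, β n ≠ 0
  αL_ne_zero : ∀ n, αL n ≠ 0
  αR_ne_zero : ∀ n, αR n ≠ 0

namespace MPFraction

variable (F : MPFraction)

/-- The tridiagonal matrix of polynomials `zB - A`: diagonal `βᵢ`, entries `-αᵢᴿ` in position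
`(i, i + 1)` and `-αᵢᴸ` in position `(i + 1, i)`. -/
def pencil : Matrix ℕ ℕ ℂ[X] := fun i j =>
  if i = j then F.β i
  else if j = i + 1 then -F.αR i
  else if i = j + 1 then -F.αL j
  else 0

/-- The matrix `B` of coefficients of `z` in the pencil `zB - A`. -/
def matB : Matrix ℕ ℕ ℂ := fun i j => (F.pencil i j).coeff 1

/-- The matrix `A` in the pencil `zB - A`. -/
def matA : Matrix ℕ ℕ ℂ := fun i j => -(F.pencil i j).coeff 0

theorem pencil_eq_zero {i j : ℕ} (h : i + 1 < j ∨ j + 1 < i) : F.pencil i j = 0 := by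
  unfold pencil
  rw [if_neg (by omega), if_neg (by omega), if_neg (by omega)]

theorem matB_tridiagonal : IsTridiagonal F.matB := fun i j h => by
  simp [matB, F.pencil_eq_zero h]

theorem matA_tridiagonal : IsTridiagonal F.matA := fun i j h => by
  simp [matA, F.pencil_eq_zero h]

/-- The entries of `zB - A` are the values of the polynomials in the pencil. -/
theorem pencil_eval (z : ℂ) (i j : ℕ) :
    (F.pencil i j).eval z = z * F.matB i j - F.matA i j := by
  have h : (F.pencil i j).natDegree ≤ 1 := by
    unfold pencil
    split_ifs
    · exact F.β_degree i
    · simpa using F.αR_degree i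
    · simpa using F.αL_degree j
    · simp
  conv_lhs => rw [Polynomial.eq_X_add_C_of_natDegree_le_one h]
  simp only [matB, matA, eval_add, eval_mul, eval_C, eval_X]
  ring

/-- The denominators: `q₋₁ = 0`, `q₀ = 1`,
`qₙ₊₁ = βₙ qₙ - αₙ₋₁ᴸ αₙ₋₁ᴿ qₙ₋₁` (with `α₋₁ᴸ = α₋₁ᴿ = 1`). -/
def q : ℕ → ℂ[X]
  | 0 => 1
  | 1 => F.β 0
  | n + 2 => F.β (n + 1) * q (n + 1) - F.αL n * F.αR n * q n

/-- The numerators: `p₋₁ = -1`, `p₀ = 0`, and the same recurrence as for the denominators. -/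
def p : ℕ → ℂ[X]
  | 0 => 0
  | 1 => 1
  | n + 2 => F.β (n + 1) * p (n + 1) - F.αL n * F.αR n * p n

/-- The `n`-th convergent `pₙ(z)/qₙ(z)`, that is, the approximant `m_[0:n-1](z)`. It is meaningful
where `qₙ(z) ≠ 0`. -/
def convergent (n : ℕ) (z : ℂ) : ℂ := (F.p n).eval z / (F.q n).eval z

end MPFraction

/-- A continued fraction whose pencil `zB - A` is bounded: the matrices `A` and `B` have bounded
entries. -/
structure BoundedMPFraction extends MPFraction where
  bounded_A : HasBoundedEntries toMPFraction.matA
  bounded_B : HasBoundedEntries toMPFraction.matB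

namespace BoundedMPFraction

variable (F : BoundedMPFraction)

/-- The bounded operator `A` on `ℓ²`. -/
def opA : Ell2 →L[ℂ] Ell2 := matrixOperator F.matA F.matA_tridiagonal F.bounded_A

/-- The bounded operator `B` on `ℓ²`. -/
def opB : Ell2 →L[ℂ] Ell2 := matrixOperator F.matB F.matB_tridiagonal F.bounded_B

/-- The resolvent set `ρ(A, B)`: all `z` for which `zB - A` has a bounded (two-sided) inverse. -/
def resolventSet : Set ℂ := {z | IsUnit (z • F.opB - F.opA)}

/-- The `m`-function `m(z) = ⟨(zB - A)⁻¹ e₀, e₀⟩` for `z ∈ ρ(A, B)`. The inner product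
of the definition is linear in its first argument, Mathlib's in its second one. -/
def m (z : ℂ) : ℂ := inner ℂ e0 (Ring.inverse (z • F.opB - F.opA) e0)

end BoundedMPFraction

end

/-! Write T = zB − A, let P_n project onto the first n coordinates, and let w = T⁻¹e₀, so that m(z)
= w₀. The residual identity w₀ q_n − p_n = w_n ∏_{j<n} α_j^R turns the error m − p_n/q_n into w_n ·
(∏_{j<n} α_j^R) / q_n, and the two factors are handled separately. The factor w_n decays
geometrically: T maps each tail of w to a vector supported on two coordinates, so the lower bound
for T controls the tail by two entries of w (`norm_tail_sq_le`). The quotient is bounded whenever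
the finite section P_n T P_n is bounded below: q_n is its determinant, and a test vector built from
q_0, q_1, … compares the product with q_n (`le_norm_eval_q`). Sections of an invertible T may
degenerate, but two consecutive ones cannot both be nearly singular (`compressionBoundedBelow_or`).
The uniform lower bound at ξ survives small perturbations, hence one choice of ε_n serves a whole
disc. -/

noncomputable section

/-! ### Minors of tridiagonal matrices -/

/-- The three-term recurrence for the leading principal minors of a tridiagonal matrix. -/
theorem IsTridiagonal.det_submatrix_fin {t : Matrix ℕ ℕ ℂ} (ht : IsTridiagonal t) (n : ℕ) :
    (t.submatrix (Fin.val : Fin (n + 2) → ℕ) Fin.val).det =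
      t (n + 1) (n + 1) * (t.submatrix (Fin.val : Fin (n + 1) → ℕ) Fin.val).det -
        t (n + 1) n * t n (n + 1) * (t.submatrix (Fin.val : Fin n → ℕ) Fin.val).det := by
  -- Only two entries of the last row survive. The minor belonging to the off-diagonal one is
  -- expanded along its last column, where a single entry is nonzero.
  rw [Matrix.det_succ_row _ (Fin.last (n + 1)), Fin.sum_univ_castSucc, Fin.sum_univ_castSucc,
    Finset.sum_eq_zero]
  · have h1 : ((t.submatrix (Fin.val : Fin (n + 2) → ℕ) Fin.val).submatrix
        (Fin.last (n + 1)).succAbove (Fin.last (n + 1)).succAbove) =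
        t.submatrix (Fin.val : Fin (n + 1) → ℕ) Fin.val := by
      ext i j
      simp
    have h2 : ((t.submatrix (Fin.val : Fin (n + 2) → ℕ) Fin.val).submatrix
        (Fin.last (n + 1)).succAbove (Fin.last n).castSucc.succAbove).det =
        t n (n + 1) * (t.submatrix (Fin.val : Fin n → ℕ) Fin.val).det := by
      rw [Matrix.det_succ_column _ (Fin.last n), Fin.sum_univ_castSucc, Finset.sum_eq_zero]
      · have h3 : (((t.submatrix (Fin.val : Fin (n + 2) → ℕ) Fin.val).submatrix
            (Fin.last (n + 1)).succAbove (Fin.last n).castSucc.succAbove).submatrix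
            (Fin.last n).succAbove (Fin.last n).succAbove) =
            t.submatrix (Fin.val : Fin n → ℕ) Fin.val := by
          ext i j
          simp [Fin.succAbove_of_castSucc_lt, Fin.lt_def]
        rw [h3]
        simp [← two_mul]
      · intro i _
        have : t (i : ℕ) (n + 1) = 0 := ht _ _ (Or.inl (by omega))
        simp [this]
    rw [h1, h2]
    have h4 : (-1 : ℂ) ^ (n + 1 + n) = -1 := Odd.neg_one_pow ⟨n, by ring⟩
    have h5 : (-1 : ℂ) ^ (n + 1 + (n + 1)) = 1 := Even.neg_one_pow ⟨n + 1, rfl⟩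
    simp only [Fin.val_last, Fin.val_castSucc, Matrix.submatrix_apply, h4, h5]
    ring
  · intro i _
    have : t (n + 1) (i : ℕ) = 0 := ht _ _ (Or.inr (by omega))
    simp [this]

/-! ### Compressions of invertible operators -/

section Hilbert

variable {H : Type*} [NormedAddCommGroup H] [InnerProductSpace ℂ H]

/-- The compression of `T` to the subspace `E` is bounded below by `η`. -/
def CompressionBoundedBelow (E : Submodule ℂ H) [E.HasOrthogonalProjection] (T : H →L[ℂ] H)
    (η : ℝ) : Prop :=
  ∀ x ∈ E, η * ‖x‖ ≤ ‖E.starProjection (T x)‖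

theorem CompressionBoundedBelow.of_norm_sub_le {E : Submodule ℂ H} [E.HasOrthogonalProjection]
    {S T : H →L[ℂ] H} {η κ : ℝ} (h : CompressionBoundedBelow E T η) (hST : ‖S - T‖ ≤ κ) :
    CompressionBoundedBelow E S (η - κ) := by
  intro x hx
  have h1 : E.starProjection (T x) = E.starProjection (S x) - E.starProjection ((S - T) x) := by
    simp
  have h2 : ‖E.starProjection ((S - T) x)‖ ≤ κ * ‖x‖ :=
    (E.norm_starProjection_apply_le _).trans ((S - T).le_of_opNorm_le hST x)
  have h3 := h x hx
  rw [h1] at h3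
  have := norm_sub_le (E.starProjection (S x)) (E.starProjection ((S - T) x))
  linarith

/-- In finite dimension an injective compression is onto, so v = P T x with η‖x‖ ≤ ‖v‖. Then ‖v‖² =
⟨P T* v, x⟩ and Cauchy–Schwarz give the bound. -/
theorem CompressionBoundedBelow.adjoint [CompleteSpace H] {E : Submodule ℂ H}
    [FiniteDimensional ℂ E] {T : H →L[ℂ] H} {η : ℝ} (hη : 0 < η)
    (h : CompressionBoundedBelow E T η) :
    CompressionBoundedBelow E (ContinuousLinearMap.adjoint T) η := by
  intro v hv
  let f : E →ₗ[ℂ] E := (E.orthogonalProjectionOnto : H →L[ℂ] E).toLinearMap ∘ₗ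
    T.toLinearMap ∘ₗ E.subtype
  have hf : ∀ x : E, (f x : H) = E.starProjection (T x) := fun x => rfl
  have hinj : Function.Injective f := by
    rw [← LinearMap.ker_eq_bot, LinearMap.ker_eq_bot']
    intro x hx
    have h1 := h x x.2
    rw [← hf, hx] at h1
    simp only [ZeroMemClass.coe_zero, norm_zero] at h1
    have h2 : ‖(x : H)‖ = 0 := le_antisymm (by nlinarith [norm_nonneg (x : H)]) (norm_nonneg _)
    exact Subtype.ext (norm_eq_zero.1 h2)
  obtain ⟨x, hx⟩ := LinearMap.injective_iff_surjective.1 hinj ⟨v, hv⟩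
  have hx' : E.starProjection (T x) = v := by rw [← hf, hx]
  have h1 : inner ℂ v v = inner ℂ (E.starProjection (ContinuousLinearMap.adjoint T v)) (x : H) := by
    calc inner ℂ v v = inner ℂ v (E.starProjection (T x)) := by rw [hx']
      _ = inner ℂ v (T x) := by
        rw [← E.inner_starProjection_left_eq_right, E.starProjection_eq_self_iff.2 hv]
      _ = _ := by
        rw [E.inner_starProjection_left_eq_right, E.starProjection_eq_self_iff.2 x.2,
          ContinuousLinearMap.adjoint_inner_left]
  have h2 := norm_inner_le_norm (𝕜 := ℂ)
    (E.starProjection (ContinuousLinearMap.adjoint T v)) (x : H)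
  rw [← h1, inner_self_eq_norm_sq_to_K, norm_pow, RCLike.norm_ofReal, abs_norm] at h2
  have h3 := h x x.2
  rw [hx'] at h3
  rcases (norm_nonneg v).eq_or_lt with h4 | h4
  · rw [← h4, mul_zero]
    positivity
  · refine le_of_mul_le_mul_right ?_ h4
    calc η * ‖v‖ * ‖v‖ = η * ‖v‖ ^ 2 := by ring
      _ ≤ ‖E.starProjection (ContinuousLinearMap.adjoint T v)‖ * (η * ‖(x : H)‖) := by
        nlinarith
      _ ≤ _ := mul_le_mul_of_nonneg_left h3 (norm_nonneg _)

/-- If both fail, some x ∈ E has T x close to a • e with `a` large, and some v ∈ E' has P' T* v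
small. Since T* v is not small, hypothesis `hv` makes ⟨v, e⟩ large. Then ⟨v, T x⟩ ≈ a⟨v, e⟩ is
large, while it equals ⟨P' T* v, x⟩, which is small. -/
theorem compressionBoundedBelow_or [CompleteSpace H] {E E' : Submodule ℂ H}
    [FiniteDimensional ℂ E] [FiniteDimensional ℂ E'] (hE : E ≤ E') {T : H →L[ℂ] H} {e : H}
    {c K η : ℝ} (hK : 0 < K) (hη : 0 < η) (hηc : 2 * η ≤ c) (hηK : 8 * K * η < c ^ 2)
    (he : ‖e‖ = 1)
    (hT : ∀ x, c * ‖x‖ ≤ ‖T x‖) (hT' : ∀ x, c * ‖x‖ ≤ ‖ContinuousLinearMap.adjoint T x‖)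
    (hx : ∀ x ∈ E, ∃ a : ℂ, T x = E.starProjection (T x) + a • e)
    (hv : ∀ v ∈ E', ‖ContinuousLinearMap.adjoint T v -
      E'.starProjection (ContinuousLinearMap.adjoint T v)‖ ≤ K * ‖inner ℂ v e‖) :
    CompressionBoundedBelow E T η ∨ CompressionBoundedBelow E' T η := by
  by_contra! hcon
  obtain ⟨h1, h2⟩ := hcon
  replace h2 := mt (CompressionBoundedBelow.adjoint (T := ContinuousLinearMap.adjoint T) hη) (by
    rwa [ContinuousLinearMap.adjoint_adjoint])
  simp only [CompressionBoundedBelow, not_forall, not_le] at h1 h2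
  obtain ⟨x, hxE, hx1⟩ := h1
  obtain ⟨v, hvE, hv1⟩ := h2
  obtain ⟨a, ha⟩ := hx x hxE
  have hx0 : 0 < ‖x‖ := by
    rcases (norm_nonneg x).eq_or_lt with h | h
    · rw [← h] at hx1
      linarith [norm_nonneg (E.starProjection (T x))]
    · exact h
  have hv0 : 0 < ‖v‖ := by
    rcases (norm_nonneg v).eq_or_lt with h | h
    · rw [← h] at hv1
      linarith [norm_nonneg (E'.starProjection (ContinuousLinearMap.adjoint T v))]
    · exact h
  have ha1 : c / 2 * ‖x‖ ≤ ‖a‖ := by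
    have h3 := hT x
    have h4 := norm_add_le (E.starProjection (T x)) (a • e)
    rw [← ha, norm_smul, he, mul_one] at h4
    nlinarith
  have hb1 : c / 2 * ‖v‖ ≤ K * ‖inner ℂ v e‖ := by
    have h3 := hT' v
    have h4 := norm_sub_norm_le (ContinuousLinearMap.adjoint T v)
      (E'.starProjection (ContinuousLinearMap.adjoint T v))
    have := hv v hvE
    nlinarith
  have h5 : inner ℂ v (T x) = inner ℂ v (E.starProjection (T x)) + a * inner ℂ v e := by
    conv_lhs => rw [ha]
    rw [inner_add_right, inner_smul_right]
  have h6 : inner ℂ v (T x) =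
      inner ℂ (E'.starProjection (ContinuousLinearMap.adjoint T v)) x := by
    rw [E'.inner_starProjection_left_eq_right, E'.starProjection_eq_self_iff.2 (hE hxE),
      ContinuousLinearMap.adjoint_inner_left]
  have h7 : ‖a‖ * ‖inner ℂ v e‖ ≤ 2 * η * (‖x‖ * ‖v‖) := by
    have h8 : a * inner ℂ v e = inner ℂ (E'.starProjection (ContinuousLinearMap.adjoint T v)) x -
        inner ℂ v (E.starProjection (T x)) := by
      rw [← h6, h5]
      ring
    rw [← norm_mul, h8]
    refine (norm_sub_le _ _).trans ?_
    have h9 := norm_inner_le_norm (𝕜 := ℂ) (E'.starProjection (ContinuousLinearMap.adjoint T v)) x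
    have h10 := norm_inner_le_norm (𝕜 := ℂ) v (E.starProjection (T x))
    nlinarith
  have h11 : (c / 2 * ‖x‖) * (c / 2 * ‖v‖) ≤ ‖a‖ * (K * ‖inner ℂ v e‖) :=
    mul_le_mul ha1 hb1 (by nlinarith) (norm_nonneg _)
  have h12 : 0 < ‖x‖ * ‖v‖ := mul_pos hx0 hv0
  have h13 : K * (‖a‖ * ‖inner ℂ v e‖) ≤ K * (2 * η * (‖x‖ * ‖v‖)) :=
    mul_le_mul_of_nonneg_left h7 hK.le
  -- Together these give c²/4 ≤ 2Kη, against 8Kη < c².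
  nlinarith

theorem exists_pos_le_norm_of_isUnit [CompleteSpace H] {T : H →L[ℂ] H} (hT : IsUnit T) :
    ∃ c > 0, (∀ x, c * ‖x‖ ≤ ‖T x‖) ∧ ∀ x, c * ‖x‖ ≤ ‖ContinuousLinearMap.adjoint T x‖ := by
  obtain ⟨u, rfl⟩ := hT
  set R : H →L[ℂ] H := ↑u⁻¹
  have key : ∀ S S' : H →L[ℂ] H, ‖S'‖ ≤ ‖R‖ → S' * S = 1 → ∀ x, (‖R‖ + 1)⁻¹ * ‖x‖ ≤ ‖S x‖ := by
    intro S S' hS h x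
    have h1 : ‖x‖ ≤ ‖R‖ * ‖S x‖ := by
      calc ‖x‖ = ‖(S' * S) x‖ := by rw [h]; rfl
        _ ≤ ‖R‖ * ‖S x‖ := S'.le_of_opNorm_le hS _
    rw [inv_mul_le_iff₀ (by positivity)]
    -- The added 1 keeps the constant positive even if R = 0.
    nlinarith [norm_nonneg (S x)]
  refine ⟨(‖R‖ + 1)⁻¹, by positivity, key _ R le_rfl (Units.inv_mul u), ?_⟩
  refine key _ (ContinuousLinearMap.adjoint R) (by simp) ?_
  rw [← ContinuousLinearMap.star_eq_adjoint, ← ContinuousLinearMap.star_eq_adjoint, ← star_mul]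
  simp [R]

end Hilbert

/-! ### Geometric decay and coordinate subspaces -/

/-- Two-step contraction of a sequence of squares gives geometric decay. -/
theorem exists_geometric_bound {θ : ℝ} (h0 : 0 < θ) (h1 : θ < 1) :
    ∃ δ : ℝ, 0 < δ ∧ δ < 1 ∧ ∀ τ : ℕ → ℝ, τ 1 ≤ τ 0 → 0 ≤ τ 0 →
      (∀ n, τ (n + 2) ≤ θ * τ n) → ∀ n, τ n ≤ τ 0 / δ ^ 2 * (δ ^ n) ^ 2 := by
  -- Fourth root: one for the two-step recursion, one because τ will be a squared norm. Dividing by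
  -- δ² covers n = 1.
  set δ := √√θ
  have hs : √θ < 1 := by rw [Real.sqrt_lt' one_pos]; simpa
  have hδ0 : 0 < δ := Real.sqrt_pos.2 (Real.sqrt_pos.2 h0)
  have hδ1 : δ < 1 := by rw [Real.sqrt_lt' one_pos]; simpa
  have hδ4 : δ ^ 4 = θ := by
    rw [show (4 : ℕ) = 2 * 2 from rfl, pow_mul, Real.sq_sqrt (Real.sqrt_nonneg _),
      Real.sq_sqrt h0.le]
  refine ⟨δ, hδ0, hδ1, fun τ hτ h hstep n => ?_⟩
  have hsq : δ ^ 2 ≤ 1 := pow_le_one₀ hδ0.le hδ1.le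
  induction n using Nat.twoStepInduction with
  | zero => simpa using le_div_self h (by positivity) hsq
  | one => rw [pow_one, div_mul_cancel₀ _ (by positivity)]; exact hτ
  | more n ih _ =>
    calc τ (n + 2) ≤ θ * τ n := hstep n
      _ ≤ θ * (τ 0 / δ ^ 2 * (δ ^ n) ^ 2) := mul_le_mul_of_nonneg_left ih h0.le
      _ = τ 0 / δ ^ 2 * (δ ^ (n + 2)) ^ 2 := by rw [← hδ4]; ring

/-- The sequences supported in `{0, …, n - 1}`. -/
def headSpace (n : ℕ) : Submodule ℂ Ell2 where
  carrier := {x | ∀ k, n ≤ k → x k = 0}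
  add_mem' hx hy k hk := by simp [hx k hk, hy k hk]
  zero_mem' k _ := by simp
  smul_mem' c x hx k hk := by simp [hx k hk]

theorem headSpace_mono {m n : ℕ} (h : m ≤ n) : headSpace m ≤ headSpace n :=
  fun _ hx k hk => hx k (h.trans hk)

theorem single_mem_headSpace {n k : ℕ} (h : k < n) (a : ℂ) :
    (lp.single 2 k a : Ell2) ∈ headSpace n := fun j hj => by
  rw [lp.single_apply_ne]
  omega

instance finiteDimensional_headSpace (n : ℕ) : FiniteDimensional ℂ (headSpace n) := by
  let f : headSpace n →ₗ[ℂ] (Fin n → ℂ) :=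
    { toFun := fun x k => (x : Ell2) k
      map_add' := fun x y => by ext; simp
      map_smul' := fun c x => by ext; simp }
  refine FiniteDimensional.of_injective f fun x y h => ?_
  ext k
  rcases lt_or_ge k n with hk | hk
  · exact congrFun h ⟨k, hk⟩
  · rw [x.2 k hk, y.2 k hk]

theorem headSpace_starProjection_apply (n : ℕ) (x : Ell2) (k : ℕ) :
    (headSpace n).starProjection x k = if k < n then x k else 0 := by
  split_ifs with hk
  · have h := (headSpace n).inner_starProjection_left_eq_right (lp.single 2 k (1 : ℂ)) x
    rw [Submodule.starProjection_eq_self_iff.2 (single_mem_headSpace hk 1),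
      lp.inner_single_left, lp.inner_single_left] at h
    simpa using h.symm
  · exact ((headSpace n).starProjection_apply_mem x) k (not_lt.1 hk)

theorem single_apply_eq (j : ℕ) (a : ℂ) (k : ℕ) :
    (lp.single 2 j a : Ell2) k = if k = j then a else 0 := by
  rw [lp.single_apply, Pi.single_apply]

/-- A finitely supported sequence as an element of `ℓ²`. -/
def finiteSeq (n : ℕ) (v : ℕ → ℂ) : Ell2 := ∑ k ∈ Finset.range n, lp.single 2 k (v k)

theorem finiteSeq_apply (n : ℕ) (v : ℕ → ℂ) (k : ℕ) :
    finiteSeq n v k = if k < n then v k else 0 := by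
  simp only [finiteSeq, lp.coeFn_sum, Finset.sum_apply, single_apply_eq]
  simp

theorem finiteSeq_mem (n : ℕ) (v : ℕ → ℂ) : finiteSeq n v ∈ headSpace n := fun k hk => by
  rw [finiteSeq_apply, if_neg (by omega)]

theorem norm_e0 : ‖e0‖ = 1 := by
  rw [e0, lp.norm_single (by norm_num)]
  simp

theorem e0_apply (k : ℕ) : e0 k = if k = 0 then 1 else 0 := by
  rw [e0, single_apply_eq]

theorem norm_apply_le (x : Ell2) (k : ℕ) : ‖x k‖ ≤ ‖x‖ := lp.norm_apply_le_norm (by norm_num) x k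

theorem norm_sub_finiteSeq_sq (x : Ell2) (n : ℕ) :
    ‖x - finiteSeq n x‖ ^ 2 = ‖x‖ ^ 2 - ∑ k ∈ Finset.range n, ‖x k‖ ^ 2 := by
  simpa [finiteSeq] using lp.norm_compl_sum_single (p := 2) (by norm_num) x (Finset.range n)

/-! ### The pencil as an operator -/

namespace BoundedMPFraction

variable (F : BoundedMPFraction)

theorem pencil_succ_self (n : ℕ) : F.pencil (n + 1) n = -F.αL n := by
  unfold MPFraction.pencil
  rw [if_neg (by omega), if_neg (by omega), if_pos rfl]

theorem pencil_self_succ (n : ℕ) : F.pencil n (n + 1) = -F.αR n := by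
  unfold MPFraction.pencil
  rw [if_neg (by omega), if_pos rfl]

theorem pencil_self (n : ℕ) : F.pencil n n = F.β n := if_pos rfl

/-- The operator `zB - A` on `ℓ²`. -/
def op (z : ℂ) : Ell2 →L[ℂ] Ell2 := z • F.opB - F.opA

theorem op_apply (z : ℂ) (x : Ell2) (i : ℕ) :
    F.op z x i = ∑' j, (F.pencil i j).eval z * x j := by
  have h : IsTridiagonal fun i j => (F.pencil i j).eval z := fun i j hij => by
    simp [F.pencil_eq_zero hij]
  rw [h.tsum_eq]
  simp only [op, opB, opA, sub_apply, smul_apply,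
    lp.coeFn_sub, lp.coeFn_smul, Pi.sub_apply, Pi.smul_apply, matrixOperator_apply,
    F.matA_tridiagonal.tsum_eq, F.matB_tridiagonal.tsum_eq, smul_eq_mul, Finset.mul_sum,
    ← Finset.sum_sub_distrib, F.pencil_eval]
  exact Finset.sum_congr rfl fun j _ => by ring

theorem op_apply_zero (z : ℂ) (x : Ell2) :
    F.op z x 0 = (F.β 0).eval z * x 0 - (F.αR 0).eval z * x 1 := by
  rw [F.op_apply, tsum_eq_sum (s := Finset.range 2)]
  · simp [Finset.sum_range_succ, pencil_self, pencil_self_succ]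
    ring
  · intro j hj
    rw [F.pencil_eq_zero (Or.inl (by simpa using hj))]
    simp

theorem op_apply_succ (z : ℂ) (x : Ell2) (i : ℕ) :
    F.op z x (i + 1) = -(F.αL i).eval z * x i + (F.β (i + 1)).eval z * x (i + 1) -
      (F.αR (i + 1)).eval z * x (i + 2) := by
  rw [F.op_apply, tsum_eq_sum (s := {i, i + 1, i + 2})]
  · rw [Finset.sum_insert (by simp), Finset.sum_pair (by simp)]
    simp [pencil_self, pencil_succ_self, pencil_self_succ]
    ring
  · intro j hj
    simp only [Finset.mem_insert, Finset.mem_singleton, not_or] at hj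
    rw [F.pencil_eq_zero (by omega)]
    simp

theorem eval_q_eq_det (z : ℂ) (n : ℕ) : (F.q n).eval z =
    ((Matrix.of fun i j => (F.pencil i j).eval z : Matrix ℕ ℕ ℂ).submatrix
      (Fin.val : Fin n → ℕ) Fin.val).det := by
  have h : IsTridiagonal (Matrix.of fun i j => (F.pencil i j).eval z) := fun i j hij => by
    simp [F.pencil_eq_zero hij]
  induction n using Nat.twoStepInduction with
  | zero => simp [MPFraction.q]
  | one => simp [MPFraction.q, pencil_self]
  | more n ih0 ih1 =>
    rw [h.det_submatrix_fin, ← ih0, ← ih1]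
    simp [MPFraction.q, pencil_self, pencil_succ_self, pencil_self_succ]

/-! ### Finite sections, residuals and decay -/

variable {F} {z : ℂ} {n : ℕ} {η : ℝ}

theorem eval_q_ne_zero (hη : 0 < η)
    (h : CompressionBoundedBelow (headSpace n) (F.op z) η) : (F.q n).eval z ≠ 0 := by
  rw [F.eval_q_eq_det]
  intro h0
  obtain ⟨v, hv0, hv⟩ := Matrix.exists_mulVec_eq_zero_iff.2 h0
  let v' : ℕ → ℂ := fun k => if hk : k < n then v ⟨k, hk⟩ else 0
  have hv' : ∀ k : Fin n, v' k = v k := fun k => by simp [v']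
  have h1 : (headSpace n).starProjection (F.op z (finiteSeq n v')) = 0 := by
    ext i
    rw [headSpace_starProjection_apply]
    split_ifs with hi
    · rw [F.op_apply, tsum_eq_sum (s := Finset.range n), Finset.sum_range]
      · simpa [Matrix.mulVec, dotProduct, finiteSeq_apply, hv'] using congrFun hv ⟨i, hi⟩
      · intro j hj
        rw [finiteSeq_mem n v' j (by simpa using hj), mul_zero]
    · simp
  have h2 := h _ (finiteSeq_mem n v')
  rw [h1, norm_zero] at h2
  have h3 : finiteSeq n v' = 0 := norm_eq_zero.1
    (le_antisymm (by nlinarith [norm_nonneg (finiteSeq n v')]) (norm_nonneg _))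
  apply hv0
  ext k
  have h4 : finiteSeq n v' k = 0 := by rw [h3]; simp
  rwa [finiteSeq_apply, if_pos k.2, hv'] at h4

theorem le_norm_eval_q (hη : 0 < η)
    (h : CompressionBoundedBelow (headSpace (n + 1)) (F.op z) η) :
    η * ‖∏ j ∈ Finset.range n, (F.αR j).eval z‖ ≤ ‖(F.q (n + 1)).eval z‖ := by
  -- The recurrence for q makes v solve every row of the section but the last, where q_{n+1} is left
  -- over. Its coordinate 0 is the full product.
  set v : ℕ → ℂ := fun k => (F.q k).eval z * ∏ j ∈ Finset.Ico k n, (F.αR j).eval z with hv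
  have hstep : ∀ k, k < n → ∏ j ∈ Finset.Ico k n, (F.αR j).eval z =
      (F.αR k).eval z * ∏ j ∈ Finset.Ico (k + 1) n, (F.αR j).eval z :=
    fun k hk => Finset.prod_eq_prod_Ico_succ_bot hk _
  have h1 : (headSpace (n + 1)).starProjection (F.op z (finiteSeq (n + 1) v)) =
      lp.single 2 n ((F.q (n + 1)).eval z) := by
    ext i
    rw [headSpace_starProjection_apply, single_apply_eq]
    rcases lt_trichotomy i n with hi | rfl | hi
    · rw [if_pos (by omega), if_neg (by omega)]
      rcases i with _ | i
      · rw [F.op_apply_zero, finiteSeq_apply, finiteSeq_apply, if_pos (by omega),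
          if_pos (by omega)]
        simp only [hv, hstep 0 hi, MPFraction.q, eval_one, zero_add]
        ring
      · rw [F.op_apply_succ, finiteSeq_apply, finiteSeq_apply, finiteSeq_apply,
          if_pos (by omega), if_pos (by omega), if_pos (by omega)]
        simp only [hv, hstep i (by omega), hstep (i + 1) hi, MPFraction.q, eval_sub, eval_mul]
        ring
    · rw [if_pos (by omega)]
      rcases i with _ | i
      · rw [F.op_apply_zero, finiteSeq_apply, finiteSeq_apply, if_pos (by omega),
          if_neg (by omega)]
        simp [hv, MPFraction.q]
      · rw [F.op_apply_succ, finiteSeq_apply, finiteSeq_apply, finiteSeq_apply,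
          if_pos (by omega), if_pos (by omega), if_neg (by omega)]
        simp [hv, MPFraction.q]
        ring
    · rw [if_neg (by omega), if_neg (by omega)]
  have h2 := h _ (finiteSeq_mem (n + 1) v)
  rw [h1, lp.norm_single (by norm_num)] at h2
  refine (mul_le_mul_of_nonneg_left ?_ hη.le).trans h2
  refine le_of_eq_of_le ?_ (norm_apply_le _ 0)
  rw [finiteSeq_apply, if_pos (by omega)]
  simp [hv, MPFraction.q]

/-- The rows of T w = e₀, multiplied by products of the α_j^R, become the recurrence satisfied by p
and q. -/
theorem eval_residual {w : Ell2} (hw : F.op z w = e0) (n : ℕ) :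
    w 0 * (F.q n).eval z - (F.p n).eval z = w n * ∏ j ∈ Finset.range n, (F.αR j).eval z := by
  induction n using Nat.twoStepInduction with
  | zero => simp [MPFraction.q, MPFraction.p]
  | one =>
    have h := F.op_apply_zero z w
    rw [hw, e0_apply, if_pos rfl] at h
    simp only [MPFraction.q, MPFraction.p, eval_one, Finset.prod_range_one]
    rw [h]
    ring
  | more n ih0 ih1 =>
    have h := F.op_apply_succ z w n
    rw [hw, e0_apply, if_neg (by omega)] at h
    simp only [MPFraction.q, MPFraction.p, eval_sub, eval_mul]
    rw [Finset.prod_range_succ] at ih1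
    rw [Finset.prod_range_succ, Finset.prod_range_succ]
    linear_combination (F.β (n + 1)).eval z * ih1 -
      (F.αL n).eval z * (F.αR n).eval z * ih0 -
      (∏ j ∈ Finset.range n, (F.αR j).eval z) * (F.αR n).eval z * h

theorem exists_entry_bound (F : BoundedMPFraction) (ξ : ℂ) : ∃ K > 0, ∀ z, ‖z - ξ‖ ≤ 1 → ∀ n,
    ‖(F.αL n).eval z‖ ≤ K ∧ ‖(F.αR n).eval z‖ ≤ K := by
  obtain ⟨CA, hA⟩ := F.bounded_A
  obtain ⟨CB, hB⟩ := F.bounded_B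
  have hA0 : 0 ≤ CA := (norm_nonneg _).trans (hA 0 0)
  have hB0 : 0 ≤ CB := (norm_nonneg _).trans (hB 0 0)
  refine ⟨(‖ξ‖ + 1) * CB + CA + 1, by positivity, fun z hz n => ?_⟩
  have hz' : ‖z‖ ≤ ‖ξ‖ + 1 := by
    have := norm_sub_norm_le z ξ
    linarith
  have h : ∀ i j, ‖(F.pencil i j).eval z‖ ≤ (‖ξ‖ + 1) * CB + CA + 1 := fun i j => by
    rw [F.pencil_eval]
    refine (norm_sub_le _ _).trans ?_
    rw [norm_mul]
    have := mul_le_mul hz' (hB i j) (norm_nonneg _) (by positivity)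
    linarith [hA i j]
  exact ⟨by simpa [pencil_self, pencil_succ_self, pencil_self_succ] using h (n + 1) n,
    by simpa [pencil_self, pencil_succ_self, pencil_self_succ] using h n (n + 1)⟩

/-- Cutting w between n and n + 1 disturbs only the two rows coupled across the cut; row 0, which
carries e₀, lies on the removed side. -/
theorem op_tail {w : Ell2} (hw : F.op z w = e0) (n : ℕ) :
    F.op z (w - finiteSeq (n + 1) w) =
      lp.single 2 n (-((F.αR n).eval z * w (n + 1))) +
        lp.single 2 (n + 1) ((F.αL n).eval z * w n) := by
  have hc : ∀ k, (w - finiteSeq (n + 1) w) k = if k < n + 1 then 0 else w k := fun k => by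
    rw [lp.coeFn_sub, Pi.sub_apply, finiteSeq_apply]
    split_ifs <;> simp
  ext i
  rw [lp.coeFn_add, Pi.add_apply, single_apply_eq, single_apply_eq]
  rcases i with _ | i
  · rw [F.op_apply_zero, hc, hc, if_pos (by omega)]
    rcases n with _ | n
    · simp
    · simp
  · rw [F.op_apply_succ, hc, hc, hc]
    have h := F.op_apply_succ z w i
    rw [hw, e0_apply, if_neg (by omega)] at h
    rcases lt_trichotomy (i + 1) n with hi | rfl | hi
    · rw [if_pos (by omega), if_pos (by omega), if_pos (by omega), if_neg (by omega),
        if_neg (by omega)]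
      simp
    · simp
    · rcases Nat.lt_succ_iff.1 hi |>.eq_or_lt with rfl | hi'
      · simp
        linear_combination -h
      · rw [if_neg (by omega), if_neg (by omega), if_neg (by omega), if_neg (by omega),
          if_neg (by omega), ← h]
        simp

/-- With t_n the squared tail, c² t_{n+1} ≤ 2K²(‖w_n‖² + ‖w_{n+1}‖²) = 2K²(t_n − t_{n+2}). Since
t_{n+2} ≤ t_{n+1}, solving for t_{n+2} gives the ratio. -/
theorem norm_tail_sq_le {w : Ell2} (hw : F.op z w = e0) {c K : ℝ} (hc : 0 < c) (hK : 0 < K)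
    (hT : ∀ x, c * ‖x‖ ≤ ‖F.op z x‖)
    (hα : ∀ n, ‖(F.αL n).eval z‖ ≤ K ∧ ‖(F.αR n).eval z‖ ≤ K) (n : ℕ) :
    ‖w - finiteSeq (n + 2) w‖ ^ 2 ≤
      2 * K ^ 2 / (2 * K ^ 2 + c ^ 2) * ‖w - finiteSeq n w‖ ^ 2 := by
  have h1 := hT (w - finiteSeq (n + 1) w)
  rw [op_tail hw] at h1
  have h2 : c * ‖w - finiteSeq (n + 1) w‖ ≤ K * (‖w n‖ + ‖w (n + 1)‖) := by
    refine h1.trans ((norm_add_le _ _).trans ?_)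
    rw [lp.norm_single (by norm_num), lp.norm_single (by norm_num), norm_neg, norm_mul, norm_mul]
    have := mul_le_mul_of_nonneg_right (hα n).1 (norm_nonneg (w n))
    have := mul_le_mul_of_nonneg_right (hα n).2 (norm_nonneg (w (n + 1)))
    linarith
  have h3 : (c * ‖w - finiteSeq (n + 1) w‖) ^ 2 ≤ (K * (‖w n‖ + ‖w (n + 1)‖)) ^ 2 := by
    gcongr
  have h4 : (‖w n‖ + ‖w (n + 1)‖) ^ 2 ≤ 2 * (‖w n‖ ^ 2 + ‖w (n + 1)‖ ^ 2) := add_sq_le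
  rw [mul_pow, mul_pow] at h3
  rw [div_mul_eq_mul_div, le_div_iff₀ (by positivity)]
  simp only [norm_sub_finiteSeq_sq, Finset.sum_range_succ] at h3 ⊢
  have h5 := h3.trans (mul_le_mul_of_nonneg_left h4 (by positivity))
  nlinarith [mul_nonneg (sq_nonneg c) (sq_nonneg ‖w (n + 1)‖)]

/-- The rate δ depends on c and K only, which makes the decay uniform in z. -/
theorem exists_norm_apply_le_geometric {c K : ℝ} (hc : 0 < c) (hK : 0 < K) :
    ∃ δ : ℝ, 0 < δ ∧ δ < 1 ∧ ∀ (F : BoundedMPFraction) (z : ℂ) (w : Ell2), F.op z w = e0 →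
      (∀ x, c * ‖x‖ ≤ ‖F.op z x‖) →
      (∀ n, ‖(F.αL n).eval z‖ ≤ K ∧ ‖(F.αR n).eval z‖ ≤ K) →
      ∀ n, ‖w n‖ ≤ c⁻¹ / δ * δ ^ n := by
  obtain ⟨δ, hδ0, hδ1, h⟩ := exists_geometric_bound (θ := 2 * K ^ 2 / (2 * K ^ 2 + c ^ 2))
    (by positivity) (by rw [div_lt_one (by positivity)]; nlinarith [sq_pos_of_pos hc])
  refine ⟨δ, hδ0, hδ1, fun F z w hw hT hα n => ?_⟩
  have h1 := h (fun n => ‖w - finiteSeq n w‖ ^ 2)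
    (by simp only [norm_sub_finiteSeq_sq]; simp) (by positivity)
    (fun n => norm_tail_sq_le hw hc hK hT hα n) n
  have h2 : ‖w n‖ ≤ ‖w - finiteSeq n w‖ := by
    refine le_of_eq_of_le ?_ (norm_apply_le _ n)
    simp [finiteSeq_apply]
  have h3 : ‖w‖ ≤ c⁻¹ := by
    have := hT w
    rw [hw, norm_e0] at this
    rwa [← one_div, le_div_iff₀' hc]
  have h4 : ‖w - finiteSeq n w‖ ^ 2 ≤ (‖w‖ / δ * δ ^ n) ^ 2 := by
    refine h1.trans_eq ?_
    simp [finiteSeq]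
    ring
  refine h2.trans ((pow_le_pow_iff_left₀ (norm_nonneg _) (by positivity) two_ne_zero).1 h4
    |>.trans ?_)
  gcongr

theorem exists_compressionBoundedBelow (F : BoundedMPFraction) {ξ : ℂ}
    (hξ : ξ ∈ F.resolventSet) : ∃ η > 0, ∀ n,
      CompressionBoundedBelow (headSpace n) (F.op ξ) η ∨
        CompressionBoundedBelow (headSpace (n + 1)) (F.op ξ) η := by
  obtain ⟨c, hc, hT, hT'⟩ := exists_pos_le_norm_of_isUnit (T := F.op ξ) hξ
  obtain ⟨K, hK, hα⟩ := F.exists_entry_bound ξ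
  -- The first term ensures 2η ≤ c, the second 8Kη ≤ c²/2 < c².
  refine ⟨min (c / 2) (c ^ 2 / (16 * K)), by positivity, fun n => ?_⟩
  refine compressionBoundedBelow_or (e := lp.single 2 n 1) (c := c) (K := K)
    (headSpace_mono n.le_succ) hK
    (by positivity) (by linarith [min_le_left (c / 2) (c ^ 2 / (16 * K))]) ?_
    (by rw [lp.norm_single (by norm_num)]; simp) hT hT' ?_ ?_
  · have h1 := min_le_right (c / 2) (c ^ 2 / (16 * K))
    rw [le_div_iff₀ (by positivity)] at h1
    nlinarith [sq_pos_of_pos hc]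
  · intro x hx
    refine ⟨F.op ξ x n, ?_⟩
    ext k
    rw [lp.coeFn_add, Pi.add_apply, headSpace_starProjection_apply, lp.coeFn_smul, Pi.smul_apply,
      single_apply_eq]
    rcases lt_trichotomy k n with hk | rfl | hk
    · rw [if_pos hk, if_neg hk.ne]
      simp
    · simp
    · rw [if_neg (by omega), if_neg hk.ne']
      obtain ⟨k, rfl⟩ := Nat.exists_eq_succ_of_ne_zero (by omega : k ≠ 0)
      rw [Nat.succ_eq_add_one, F.op_apply_succ, hx k (by omega), hx (k + 1) (by omega),
        hx (k + 2) (by omega)]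
      simp
  · intro v hv
    have hcoord : ∀ k, ContinuousLinearMap.adjoint (F.op ξ) v k =
        inner ℂ (F.op ξ (lp.single 2 k 1)) v := fun k => by
      rw [← ContinuousLinearMap.adjoint_inner_right, lp.inner_single_left]
      simp
    -- As v vanishes beyond n, the only column outside the section that meets it is n + 1, through
    -- α_n^R.
    have h1 : ContinuousLinearMap.adjoint (F.op ξ) v -
        (headSpace (n + 1)).starProjection (ContinuousLinearMap.adjoint (F.op ξ) v) =
        lp.single 2 (n + 1) (-(starRingEnd ℂ ((F.αR n).eval ξ) * v n)) := by
      ext k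
      rw [lp.coeFn_sub, Pi.sub_apply, headSpace_starProjection_apply, single_apply_eq]
      by_cases hk : k < n + 1
      · rw [if_pos hk, if_neg (by omega), sub_self]
      · rw [if_neg hk, sub_zero, hcoord, lp.inner_eq_tsum, tsum_eq_single n]
        · obtain ⟨k, rfl⟩ := Nat.exists_eq_succ_of_ne_zero (by omega : k ≠ 0)
          rw [F.op_apply, tsum_eq_single (k + 1)]
          · by_cases hkn : k = n
            · subst hkn
              simp [pencil_self_succ]
              ring
            · rw [F.pencil_eq_zero (by omega), if_neg (by omega)]
              simp
          · intro j hj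
            rw [lp.single_apply_ne _ _ _ hj, mul_zero]
        · intro j hj
          rcases Nat.lt_or_ge j (n + 1) with hjn | hjn
          · rw [F.op_apply, tsum_eq_single k, F.pencil_eq_zero (by omega)]
            · simp
            · intro i hi
              rw [lp.single_apply_ne _ _ _ hi, mul_zero]
          · rw [hv j hjn, inner_zero_right]
    rw [h1, lp.norm_single (by norm_num), lp.inner_single_right, norm_neg, norm_mul]
    simpa using mul_le_mul_of_nonneg_right (hα ξ (by simp) n).2 (norm_nonneg (v n))

end BoundedMPFraction

end

/-! ### Convergence near a point of the resolvent set -/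

theorem theorem3p5 (F : BoundedMPFraction) (ξ : ℂ) (hξ : ξ ∈ F.resolventSet) :
    ∃ (V : Set ℂ) (ε : ℕ → ℕ),
      IsClosed V ∧ V ∈ 𝓝 ξ ∧ V ⊆ F.resolventSet ∧
      (∀ n, ε n = 0 ∨ ε n = 1) ∧
      (∀ n, ∀ z ∈ V, (F.q (n + ε n)).eval z ≠ 0) ∧
      TendstoUniformlyOn (fun n z => F.convergent (n + ε n) z) F.m atTop V ∧
      ∃ C : ℝ, 0 < C ∧ ∃ δ : ℝ, 0 < δ ∧ δ < 1 ∧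
        ∀ n, ∀ z ∈ V, ‖F.m z - F.convergent (n + ε n) z‖ ≤ C * δ ^ n := by
  obtain ⟨c, hc, hT, -⟩ := exists_pos_le_norm_of_isUnit (T := F.op ξ) hξ
  obtain ⟨K, hK, hα⟩ := F.exists_entry_bound ξ
  obtain ⟨η, hη, hor⟩ := F.exists_compressionBoundedBelow hξ
  obtain ⟨δ, hδ0, hδ1, hdecay⟩ :=
    BoundedMPFraction.exists_norm_apply_le_geometric (half_pos hc) hK
  have hcont : Continuous F.op := (continuous_id.smul continuous_const).sub continuous_const
  have hnear : ∀ᶠ z in 𝓝 ξ, z ∈ F.resolventSet ∧ ‖z - ξ‖ ≤ 1 ∧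
      ‖F.op z - F.op ξ‖ ≤ c / 2 ∧ ‖F.op z - F.op ξ‖ ≤ η / 2 := by
    have h1 : ∀ᶠ z in 𝓝 ξ, z ∈ F.resolventSet :=
      (Units.isOpen.preimage hcont).mem_nhds hξ
    have h2 : ∀ r : ℝ, 0 < r → ∀ᶠ z in 𝓝 ξ, ‖F.op z - F.op ξ‖ ≤ r := fun r hr => by
      filter_upwards [hcont.tendsto ξ (Metric.closedBall_mem_nhds _ hr)] with z hz
      simpa [dist_eq_norm] using hz
    have h3 : ∀ᶠ z in 𝓝 ξ, ‖z - ξ‖ ≤ 1 := by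
      filter_upwards [Metric.closedBall_mem_nhds ξ one_pos] with z hz
      simpa [dist_eq_norm] using hz
    exact h1.and (h3.and ((h2 _ (half_pos hc)).and (h2 _ (half_pos hη))))
  obtain ⟨r, hr, hV⟩ := Metric.nhds_basis_closedBall.mem_iff.1 hnear
  classical
  set ε : ℕ → ℕ := fun n => if CompressionBoundedBelow (headSpace n) (F.op ξ) η then 0 else 1
  have hε : ∀ n, CompressionBoundedBelow (headSpace (n + ε n)) (F.op ξ) η := fun n => by
    by_cases h : CompressionBoundedBelow (headSpace n) (F.op ξ) η
    · simp [ε, h]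
    · simpa [ε, h] using (hor n).resolve_left h
  have hεz : ∀ n, ∀ z ∈ Metric.closedBall ξ r,
      CompressionBoundedBelow (headSpace (n + ε n)) (F.op z) (η / 2) := fun n z hz => by
    simpa only [sub_half] using (hε n).of_norm_sub_le (hV hz).2.2.2
  set W := (c / 2)⁻¹ / δ
  have hW : 0 < W := by positivity
  have hbound : ∀ n, ∀ z ∈ Metric.closedBall ξ r,
      ‖F.m z - F.convergent (n + ε n) z‖ ≤ W * (K / (η / 2) + 1) * δ ^ n := fun n z hz => by
    obtain ⟨hz1, hz2, hz3, -⟩ := hV hz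
    set w : Ell2 := Ring.inverse (F.op z) e0 with hw_def
    have hw : F.op z w = e0 := by
      have h := congrArg (fun S : Ell2 →L[ℂ] Ell2 => S e0) (Ring.mul_inverse_cancel (F.op z) hz1)
      exact h
    have hm : F.m z = w 0 := by
      change inner ℂ e0 w = w 0
      rw [e0, lp.inner_single_left]
      simp
    have hTz : ∀ x, c / 2 * ‖x‖ ≤ ‖F.op z x‖ := fun x => by
      have h1 := hT x
      have h2 := (F.op z - F.op ξ).le_of_opNorm_le hz3 x
      have h3 := norm_sub_norm_le (F.op ξ x) (F.op z x)
      rw [norm_sub_rev] at h3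
      rw [sub_apply] at h2
      linarith
    have hwn := hdecay F z w hw hTz (hα z hz2) (n + ε n)
    have hpow : δ ^ (n + ε n) ≤ δ ^ n := pow_le_pow_of_le_one hδ0.le hδ1.le (Nat.le_add_right _ _)
    have hq := BoundedMPFraction.eval_q_ne_zero (half_pos hη) (hεz n z hz)
    have hquot : ‖∏ j ∈ Finset.range (n + ε n), (F.αR j).eval z‖ / ‖(F.q (n + ε n)).eval z‖ ≤
        K / (η / 2) + 1 := by
      have h := hεz n z hz
      generalize n + ε n = N at h hq
      rw [div_le_iff₀ (norm_pos_iff.2 hq)]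
      -- For N = 0 the quotient is 1, hence the summand 1 in the bound. Otherwise the test vector
      -- bounds a product one factor shorter, and the last α^R costs K.
      rcases N with _ | N
      · simp [MPFraction.q]
        positivity
      · have h1 := BoundedMPFraction.le_norm_eval_q (half_pos hη) h
        rw [Finset.prod_range_succ, norm_mul]
        have h2 : ‖∏ j ∈ Finset.range N, (F.αR j).eval z‖ ≤
            ‖(F.q (N + 1)).eval z‖ / (η / 2) := by
          rwa [le_div_iff₀' (half_pos hη)]
        calc _ ≤ ‖(F.q (N + 1)).eval z‖ / (η / 2) * K :=
              mul_le_mul h2 (hα z hz2 N).2 (norm_nonneg _) (by positivity)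
          _ = K / (η / 2) * ‖(F.q (N + 1)).eval z‖ := by ring
          _ ≤ _ := by
            gcongr
            linarith
    have herr : F.m z - F.convergent (n + ε n) z =
        w (n + ε n) * ((∏ j ∈ Finset.range (n + ε n), (F.αR j).eval z) /
          (F.q (n + ε n)).eval z) := by
      rw [← mul_div_assoc, ← BoundedMPFraction.eval_residual hw, hm, MPFraction.convergent,
        sub_div, mul_div_cancel_right₀ _ hq]
    rw [herr, norm_mul, norm_div]
    calc _ ≤ (W * δ ^ n) * (K / (η / 2) + 1) :=
          mul_le_mul (hwn.trans (mul_le_mul_of_nonneg_left hpow hW.le)) hquot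
            (by positivity) (by positivity)
      _ = _ := by ring
  have hC : 0 < W * (K / (η / 2) + 1) := by positivity
  refine ⟨Metric.closedBall ξ r, ε, Metric.isClosed_closedBall, Metric.closedBall_mem_nhds ξ hr,
    fun z hz => (hV hz).1, fun n => ?_, fun n z hz =>
      BoundedMPFraction.eval_q_ne_zero (half_pos hη) (hεz n z hz), ?_, _, hC, δ, hδ0, hδ1, hbound⟩
  · simp only [ε]
    split_ifs <;> simp
  · rw [Metric.tendstoUniformlyOn_iff]
    intro ρ hρ
    have hlim := (tendsto_pow_atTop_nhds_zero_of_lt_one hδ0.le hδ1).const_mul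
      (W * (K / (η / 2) + 1))
    rw [mul_zero] at hlim
    filter_upwards [hlim.eventually_lt_const hρ] with n hn z hz
    rw [dist_eq_norm]
    exact (hbound n z hz).trans_lt hn
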